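/- **Model (OSOW with post-allocation stochasticity).** Let $I$ be a finite set of resources and let $t=1,\dots,T$ be a finite sequence of arrivals. A configuration is a pair $(R,t)$ with $R\subseteq I$; $N_t$ is the set of feasible configurations at arrival $t$, $N=\bigcup_t N_t$ and $N_i=\{(R,t)\in N: i\in R\}$. A total order on $N$ is arrival-consistent if all elements of $N_t$ precede all elements of $N_{t'}$ whenever $t<t'$. Each resource $i$ has a monotone function $f_i:2^N\to\mathbb{R}$ with $f_i(\emptyset)=0$ and $f_i(S)=f_i(S\cap N_i)$ for all $S\subseteq N$, which is submodular order (SO) on the arrival order: for every arrival-consistent total order $\pi$ on $N$, all $B\subseteq A\subseteq N$ such that every element of $A\setminus B$ succeeds every element of $B$ in $\pi$, and all $C\subseteq N$ such that every element of $C$ succeeds every element of $A$ in $\pi$, one has $f_i(A\cup C)-f_i(A)\le f_i(B\cup C)-f_i(B)$. If configuration $e=(R,t)$ is chosen, then each resource $i\in R$ is randomly active or inactive in $e$; let $p_{i,e}$ be the probability that $i$ is active in $e$. Within one arrival these events may be arbitrarily correlated; the families of events of different arrivals are mutually independent. The total reward of a chosen set $S\subseteq N$ with at most one configuration per arrival is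 $\sum_{i\in I} f_i(\{e\in S\cap N_i: i\text{ is active in }e\})$. **Non-adaptive Greedy.** For $S\subseteq N$ let \[F_i(S)=\sum_{X\subseteq N_i}\Big(\prod_{e\in X}p_{i,e}\prod_{e\in N_i\setminus X}(1-p_{i,e})\Big)f_i(X\cap S).\] At arrivals $t=1,\dots,T$ in turn, Greedy chooses some $e\in N_t$ that maximizes $\sum_{i\in I}\big(F_i(A_{<t}\cup\{e\})-F_i(A_{<t})\big)$ over $N_t$, where $A_{<t}$ is the set of configurations it chose before $t$ (ties are broken arbitrarily; nothing is chosen if $N_t=\emptyset$). Let $\mathrm{ALG}$ be the expected total reward of the set it chooses. **Benchmark.** A non-anticipative adaptive offline policy knows the whole instance (including the joint distribution of the activity events), processes the arrivals in any order, which may be chosen adaptively, and chooses at most one configuration for each arrival. Directly after choosing a configuration $e=(R,t)$ it observes which $i\in R$ are active in $e$, and its later decisions may depend on the observations made so far. $\mathrm{AOPT}$ is the supremum of the expected total reward over all such policies. **Claim.** For every instance, a run of non-adaptive Greedy exists, $\mathrm{AOPT}$ is finite, and every run of non-adaptive Greedy satisfies \[\mathrm{ALG}\ \ge\ \tfrac12\,\mathrm{AOPT}.\]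 -/

import Mathlib

open MeasureTheory ProbabilityTheory

noncomputable section

namespace OSOW

universe u v

section SubmodularOrder

variable {E : Type u} [DecidableEq E]

/-- Marginal value `f(X | S) = f(X ∪ S) - f(S)`. -/
def marginal (f : Finset E → ℝ) (X S : Finset E) : ℝ := f (X ∪ S) - f S

/-- The set `C` succeeds the set `A` in the (strict) order `r`. -/
def Succeeds (r : E → E → Prop) (C A : Finset E) : Prop := ∀ c ∈ C, ∀ a ∈ A, r a c

/-- `B ⊆ A` are nested in the order `r`: `B` is a prefix of `A`. -/
def IsNested (r : E → E → Prop) (B A : Finset E) : Prop := B ⊆ A ∧ Succeeds r (A \ B) B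

/-- `r` is a submodular order for `f`. -/
def IsSubmodularOrder (r : E → E → Prop) (f : Finset E → ℝ) : Prop :=
  ∀ A B C : Finset E, IsNested r B A → Succeeds r C A → marginal f C A ≤ marginal f C B

/-- `r` is consistent with the arrival times `arr` of the elements. -/
def ArrivalConsistent {T : ℕ} (arr : E → Fin T) (r : E → E → Prop) : Prop :=
  ∀ e e' : E, arr e < arr e' → r e e'

/-- `f` is submodular order on the arrival order: every arrival-consistent (strict) total order
is a submodular order for `f`. -/
def IsSubmodularOnArrivalOrder {T : ℕ} (arr : E → Fin T) (f : Finset E → ℝ) : Prop :=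
  ∀ r : E → E → Prop, IsStrictTotalOrder E r → ArrivalConsistent arr r → IsSubmodularOrder r f

end SubmodularOrder

/-- The arrival `t` of a configuration `(R, t)`. -/
def arrival {I : Type u} {T : ℕ} {N : Finset (Finset I × Fin T)} (e : N) : Fin T := e.1.2

/-- The set of resources `R` of a configuration `(R, t)`. -/
def resources {I : Type u} {T : ℕ} {N : Finset (Finset I × Fin T)} (e : N) : Finset I := e.1.1

/-- An instance of online submodular order welfare maximization with configurations and
post-allocation stochasticity, with resources `I` and arrivals `0, …, T - 1` in this order. -/
structure Instance (I : Type u) [Fintype I] [DecidableEq I] (T : ℕ)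
    (Ω : Type v) [MeasurableSpace Ω] (P : Measure Ω) where
  /-- The feasible configurations. -/
  N : Finset (Finset I × Fin T)
  /-- The objective function of each resource, on sets of configurations. -/
  f : I → Finset N → ℝ
  f_empty : ∀ i, f i ∅ = 0
  f_mono : ∀ i, Monotone (f i)
  f_local : ∀ i S, f i S = f i (S.filter (fun e => i ∈ resources e))
  f_submodularOrder : ∀ i, IsSubmodularOnArrivalOrder arrival (f i)
  /-- `act e i` is the event that resource `i` is active in configuration `e`; it is used only for
  `i ∈ resources e`. -/
  act : N → I → Set Ω
  act_measurable : ∀ e, ∀ i ∈ resources e, MeasurableSet (act e i)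
  /-- Events of different arrivals are independent. Within one arrival they may be arbitrarily
  correlated. -/
  act_indep : iIndep (fun t : Fin T => MeasurableSpace.generateFrom
    {s : Set Ω | ∃ e : N, arrival e = t ∧ ∃ i ∈ resources e, s = act e i}) P

/-- A deterministic adaptive policy, as a decision tree: either finish, or choose a configuration
`e`, observe the set of resources that are active in `e`, and continue depending on this set. -/
inductive Policy (E : Type u) (I : Type v) : Type (max u v)
  | finish : Policy E I
  | choose (e : E) (next : Finset I → Policy E I) : Policy E I

namespace Policy

variable {E : Type u} {I : Type v}

/-- No arrival in `used` is processed by the policy and no arrival is processed twice. -/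
def FeasibleFrom {T : ℕ} (arr : E → Fin T) : Policy E I → Finset (Fin T) → Prop
  | finish, _ => True
  | choose e next, used =>
      arr e ∉ used ∧ ∀ Z : Finset I, (next Z).FeasibleFrom arr (insert (arr e) used)

/-- The policy chooses at most one configuration per arrival. The order in which arrivals are
processed is free and may be adaptive. -/
def Feasible {T : ℕ} (arr : E → Fin T) (p : Policy E I) : Prop := p.FeasibleFrom arr ∅

/-- The set of configurations the policy chooses if `o e` is the set of resources that are active
in `e` (seen by the policy only for a chosen `e`, after choosing it). -/
def chosen [DecidableEq E] : Policy E I → (E → Finset I) → Finset E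
  | finish, _ => ∅
  | choose e next, o => insert e ((next (o e)).chosen o)

end Policy

namespace Instance

variable {I : Type u} [Fintype I] [DecidableEq I] {T : ℕ}
  {Ω : Type v} [MeasurableSpace Ω] {P : Measure Ω} (G : Instance I T Ω P)

/-- `N_t`, the feasible configurations at arrival `t`. -/
def Nt (t : Fin T) : Finset G.N := Finset.univ.filter (fun e => arrival e = t)

/-- `N_i`, the feasible configurations that contain resource `i`. -/
def Ni (i : I) : Finset G.N := Finset.univ.filter (fun e => i ∈ resources e)

/-- `p_{i,e}`, the probability that `i` is active in configuration `e`. -/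
def prob (i : I) (e : G.N) : ℝ := P.real (G.act e i)

/-- `γ(X, S) = ∏_{e ∈ X} p_{i,e} ∏_{e ∈ S \ X} (1 - p_{i,e})`. -/
def gamma (i : I) (X S : Finset G.N) : ℝ :=
  (∏ e ∈ X, G.prob i e) * ∏ e ∈ S \ X, (1 - G.prob i e)

/-- `F_i(S) = ∑_{X ⊆ N_i} γ(X, N_i) f_i(X ∩ S)`. -/
def F (i : I) (S : Finset G.N) : ℝ :=
  ∑ X ∈ (G.Ni i).powerset, G.gamma i X (G.Ni i) * G.f i (X ∩ S)

/-- The marginal value `∑_i F_i(e | S)` of adding configuration `e` to `S`. -/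
def gain (e : G.N) (S : Finset G.N) : ℝ := ∑ i, marginal (G.F i) {e} S

/-- The configurations in `A` that belong to arrivals before `t`. -/
def before (A : Finset G.N) (t : Fin T) : Finset G.N := A.filter (fun e => arrival e < t)

/-- `A` is the output of a run of non-adaptive Greedy (with arbitrary tie-breaking): at every
arrival `t` with a feasible configuration, `A` contains exactly one configuration of `N_t`, and it
maximizes the marginal value over `N_t`, given the choices made before `t`. -/
def IsGreedy (A : Finset G.N) : Prop :=
  ∀ t : Fin T, (G.Nt t).Nonempty →
    ∃ e ∈ G.Nt t, A ∩ G.Nt t = {e} ∧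
      ∀ e' ∈ G.Nt t, G.gain e' (G.before A t) ≤ G.gain e (G.before A t)

open Classical in
/-- The set of resources that are active in configuration `e`, in the realization `ω`. -/
def outcome (ω : Ω) (e : G.N) : Finset I := (resources e).filter (fun i => ω ∈ G.act e i)

/-- The total reward of choosing the set `S` of configurations, in the realization `ω`. -/
def reward (S : Finset G.N) (ω : Ω) : ℝ :=
  ∑ i, G.f i (S.filter (fun e => i ∈ G.outcome ω e))

/-- The expected total reward of the non-adaptive choice `A`. -/
def alg (A : Finset G.N) : ℝ := ∫ ω, G.reward A ω ∂P

/-- The expected total reward of an adaptive policy. -/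
def policyValue (p : Policy G.N I) : ℝ := ∫ ω, G.reward (p.chosen (G.outcome ω)) ω ∂P

/-- The expected total rewards of all feasible adaptive, non-anticipative policies. -/
def adaptiveValues : Set ℝ :=
  {x : ℝ | ∃ p : Policy G.N I, p.Feasible arrival ∧ x = G.policyValue p}

/-- The value of the optimal adaptive, non-anticipative offline algorithm. -/
def aopt : ℝ := sSup G.adaptiveValues

end Instance

end OSOW

end

/-! Let `A` be the greedy choice and `D` the active part of `A` for resource `i` in a fresh sample,
independent of what the policy sees. For any set `S`, adding the elements of `S` to `D` from the
latest arrival to the earliest and using submodular order gives f_i(S) ≤ f_i(S ∪ D) ≤ f_i(D) + the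
sum over `S` of marginals relative to the part of `D` that arrives strictly earlier
(`IsSubmodularOnArrivalOrder.union_le`). Averaging over `D` alone turns this into `f_le_F_add_sum`,
valid for every fixed `S`, hence also for the random set of configurations chosen by the policy in
which `i` is active.

A feasible policy decides whether to choose `e` without seeing anything from the arrival of `e`
(`Policy.mem_chosen_congr`). So activity in `e` is independent of that choice (`integral_act_mul`),
and its probability turns the conditional gain into the marginal of `F` at the earlier greedy
choices. In every realization the policy chooses at most one configuration per arrival, so these
marginals sum to at most the greedy gains, which telescope to the value of `A`. Thus every policy
earns at most twice that value. Correlation within an arrival is harmless because `A` has at most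
one configuration there. -/

namespace OSOW

/-! ### Submodular order inequalities for a fixed set function. -/

section Deterministic

variable {E : Type*} [DecidableEq E]

/-- For every element there is an arrival-consistent strict total order in which this element
comes first among the elements with the same arrival. -/
theorem exists_arrivalConsistent_first [Fintype E] {T : ℕ} (arr : E → Fin T) (s : E) :
    ∃ r : E → E → Prop, IsStrictTotalOrder E r ∧ ArrivalConsistent arr r ∧
      ∀ c, arr s ≤ arr c → c ≠ s → r s c := by
  -- The Boolean is `false` only at `s`, which puts `s` first within its arrival; the enumeration
  -- breaks the remaining ties.
  let key : E → Fin T ×ₗ (Bool ×ₗ Fin (Fintype.card E)) := fun e =>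
    toLex (arr e, toLex (decide (e ≠ s), Fintype.equivFin E e))
  have hkey : Function.Injective key := by
    intro a b hab
    have h : (Fintype.equivFin E a) = Fintype.equivFin E b :=
      congrArg (fun z => (ofLex (ofLex z).2).2) hab
    exact (Fintype.equivFin E).injective h
  refine ⟨fun a b => key a < key b,
    (RelEmbedding.preimage ⟨key, hkey⟩ (· < ·)).isStrictTotalOrder, ?_, ?_⟩
  · intro a b hab
    exact Prod.Lex.toLex_lt_toLex.2 (Or.inl hab)
  · intro c hc hcs
    refine Prod.Lex.toLex_lt_toLex.2 ?_
    rcases hc.lt_or_eq with h | h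
    · exact Or.inl h
    · refine Or.inr ⟨h, Prod.Lex.toLex_lt_toLex.2 (Or.inl ?_)⟩
      simp [hcs]

/-- Inserting an element in the middle gains at most as much as inserting it at the end. -/
theorem IsSubmodularOnArrivalOrder.insert_sub_le [Fintype E] {T : ℕ} {arr : E → Fin T}
    {f : Finset E → ℝ} (hf : IsSubmodularOnArrivalOrder arr f) {s : E} {B C : Finset E}
    (hB : ∀ b ∈ B, arr b < arr s) (hC : ∀ c ∈ C, arr s ≤ arr c) (hs : s ∉ C) :
    f (insert s (B ∪ C)) - f (B ∪ C) ≤ f (insert s B) - f B := by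
  obtain ⟨r, hr, hcons, hfirst⟩ := exists_arrivalConsistent_first arr s
  -- Submodular order bounds the marginal of `C` over the nested pair; exchanging two terms makes it
  -- a bound on the marginal of `s`.
  have h := hf r hr hcons (insert s B) B C ⟨Finset.subset_insert _ _, ?_⟩ ?_
  · simp only [marginal] at h
    rw [Finset.union_insert, Finset.union_comm C B] at h
    linarith
  · intro a ha b hb
    obtain rfl : a = s := by
      simp only [Finset.mem_sdiff, Finset.mem_insert] at ha
      tauto
    exact hcons _ _ (hB b hb)
  · intro c hc a ha
    rcases Finset.mem_insert.1 ha with rfl | ha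
    · exact hfirst c (hC c hc) (fun h => hs (h ▸ hc))
    · exact hcons _ _ ((hB a ha).trans_le (hC c hc))

/-- The value of `S ∪ D` is at most the value of `D` plus the marginal values of the elements of
`S`, each with respect to the part of `D` that arrives earlier. -/
theorem IsSubmodularOnArrivalOrder.union_le [Fintype E] {T : ℕ} {arr : E → Fin T}
    {f : Finset E → ℝ} (hf : IsSubmodularOnArrivalOrder arr f) (hmono : Monotone f)
    (S D : Finset E) :
    f (S ∪ D) ≤ f D + ∑ s ∈ S, (f (insert s (D.filter (fun e => arr e < arr s)))
      - f (D.filter (fun e => arr e < arr s))) := by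
  induction S using Finset.induction_on_min_value arr with
  | empty => simp
  | insert s S hs hmin ih =>
    rw [Finset.sum_insert hs, Finset.insert_union]
    set B := D.filter (fun e => arr e < arr s) with hB
    -- As `s` has minimal arrival, everything in `S ∪ D` outside `B` arrives no earlier than `s`.
    have hstep : f (insert s (S ∪ D)) - f (S ∪ D) ≤ f (insert s B) - f B := by
      by_cases hsD : s ∈ D
      · rw [Finset.insert_eq_of_mem (Finset.mem_union_right _ hsD), sub_self]
        exact sub_nonneg.2 (hmono (Finset.subset_insert _ _))
      · have hsplit : S ∪ D = B ∪ (S ∪ D.filter (fun e => arr s ≤ arr e)) := by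
          ext e
          have := lt_or_ge (arr e) (arr s)
          simp only [hB, Finset.mem_union, Finset.mem_filter]
          tauto
        rw [hsplit]
        refine hf.insert_sub_le (fun b hb => (Finset.mem_filter.1 hb).2) (fun c hc => ?_) ?_
        · rcases Finset.mem_union.1 hc with h | h
          · exact hmin c h
          · exact (Finset.mem_filter.1 h).2
        · simp [hs, hsD]
    linarith

end Deterministic

/-! ### Expectations over independent random subsets. -/

section ProductWeight

variable {E : Type*} [DecidableEq E]

/-- The expectation of `g` on a random subset of `N` that contains each element `e`
independently with probability `p e`. -/
def weightedSum (p : E → ℝ) (N : Finset E) (g : Finset E → ℝ) : ℝ :=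
  ∑ X ∈ N.powerset, ((∏ e ∈ X, p e) * ∏ e ∈ N \ X, (1 - p e)) * g X

@[simp] theorem weightedSum_empty (p : E → ℝ) (g : Finset E → ℝ) :
    weightedSum p ∅ g = g ∅ := by
  simp [weightedSum]

theorem weightedSum_insert (p : E → ℝ) {N : Finset E} {e : E} (he : e ∉ N)
    (g : Finset E → ℝ) :
    weightedSum p (insert e N) g =
      p e * weightedSum p N (fun X => g (insert e X)) + (1 - p e) * weightedSum p N g := by
  unfold weightedSum
  rw [Finset.sum_powerset_insert he, add_comm, Finset.mul_sum, Finset.mul_sum]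
  refine congrArg₂ (· + ·) (Finset.sum_congr rfl fun X hX => ?_)
    (Finset.sum_congr rfl fun X hX => ?_)
  · have heX : e ∉ X := fun h => he (Finset.mem_powerset.1 hX h)
    rw [Finset.prod_insert heX, Finset.insert_sdiff_insert, Finset.sdiff_insert_of_notMem he]
    ring
  · have heX : e ∉ X := fun h => he (Finset.mem_powerset.1 hX h)
    rw [Finset.insert_sdiff_of_notMem _ heX, Finset.prod_insert (by simp [he])]
    ring

theorem weightedSum_insert_of_invariant (p : E → ℝ) {N : Finset E} {e : E} (he : e ∉ N)
    {g : Finset E → ℝ} (hg : ∀ X, g (insert e X) = g X) :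
    weightedSum p (insert e N) g = weightedSum p N g := by
  rw [weightedSum_insert p he]
  simp only [hg]
  ring

theorem weightedSum_const (p : E → ℝ) (N : Finset E) (c : ℝ) :
    weightedSum p N (fun _ => c) = c := by
  induction N using Finset.induction_on with
  | empty => simp
  | insert e N he ih => rw [weightedSum_insert_of_invariant p he (fun _ => rfl), ih]

theorem weightedSum_add (p : E → ℝ) (N : Finset E) (g h : Finset E → ℝ) :
    weightedSum p N (fun X => g X + h X) = weightedSum p N g + weightedSum p N h := by
  simp only [weightedSum, mul_add, Finset.sum_add_distrib]

theorem weightedSum_sub (p : E → ℝ) (N : Finset E) (g h : Finset E → ℝ) :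
    weightedSum p N (fun X => g X - h X) = weightedSum p N g - weightedSum p N h := by
  simp only [weightedSum, mul_sub, Finset.sum_sub_distrib]

theorem weightedSum_sum {ι : Type*} (p : E → ℝ) (N : Finset E) (S : Finset ι)
    (g : ι → Finset E → ℝ) :
    weightedSum p N (fun X => ∑ s ∈ S, g s X) = ∑ s ∈ S, weightedSum p N (g s) := by
  simp only [weightedSum, Finset.mul_sum]
  exact Finset.sum_comm

theorem weightedSum_mono {p : E → ℝ} (h0 : ∀ e, 0 ≤ p e) (h1 : ∀ e, p e ≤ 1) (N : Finset E)
    {g h : Finset E → ℝ} (hgh : ∀ X ⊆ N, g X ≤ h X) :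
    weightedSum p N g ≤ weightedSum p N h := by
  refine Finset.sum_le_sum fun X hX => ?_
  refine mul_le_mul_of_nonneg_left (hgh X (Finset.mem_powerset.1 hX)) (mul_nonneg ?_ ?_)
  · exact Finset.prod_nonneg fun e _ => h0 e
  · exact Finset.prod_nonneg fun e _ => sub_nonneg.2 (h1 e)

/-- Elements on which the function does not depend can be dropped from the ground set. -/
theorem weightedSum_inter (p : E → ℝ) (N A : Finset E) (g : Finset E → ℝ) :
    weightedSum p N (fun X => g (X ∩ A)) = weightedSum p (N ∩ A) g := by
  induction N using Finset.induction_on generalizing g with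
  | empty => simp
  | insert e N he ih =>
    by_cases heA : e ∈ A
    · have : e ∉ N ∩ A := fun h => he (Finset.mem_inter.1 h).1
      rw [weightedSum_insert p he, Finset.insert_inter_of_mem heA, weightedSum_insert p this,
        ← ih, ← ih]
      simp only [Finset.insert_inter_of_mem heA]
    · rw [Finset.insert_inter_of_notMem heA, ← ih, weightedSum_insert_of_invariant p he]
      intro X
      rw [Finset.insert_inter_of_notMem heA]

/-- The marginal value of `e` is the probability that `e` is present times its expected marginal
value if it is present. -/
theorem weightedSum_marginal (p : E → ℝ) {N A : Finset E} {e : E} (he : e ∈ N) (heA : e ∉ A)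
    (f : Finset E → ℝ) :
    weightedSum p N (fun X => f (X ∩ insert e A)) - weightedSum p N (fun X => f (X ∩ A)) =
      p e * weightedSum p N (fun X => f (insert e (X ∩ A)) - f (X ∩ A)) := by
  rw [← weightedSum_sub, ← Finset.insert_erase he,
    weightedSum_insert p (Finset.notMem_erase e N),
    weightedSum_insert_of_invariant (g := fun X => f (insert e (X ∩ A)) - f (X ∩ A)) p
      (Finset.notMem_erase e N) (fun X => by rw [Finset.insert_inter_of_notMem heA])]
  -- The branch in which `e` is absent from the sample contributes nothing.
  have h0 : weightedSum p (N.erase e) (fun X => f (X ∩ insert e A) - f (X ∩ A)) = 0 := by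
    rw [weightedSum]
    refine Finset.sum_eq_zero fun X hX => ?_
    have heX : e ∉ X := fun h => Finset.notMem_erase e N (Finset.mem_powerset.1 hX h)
    rw [Finset.inter_insert_of_notMem heX, sub_self, mul_zero]
  rw [h0, mul_zero, add_zero]
  simp only [Finset.insert_inter_of_notMem heA, ← Finset.insert_inter_distrib]

end ProductWeight

/-! ### Structure of feasible decision trees. -/

theorem Policy.arr_notMem_of_mem_chosen {E I : Type*} [DecidableEq E] {T : ℕ} {arr : E → Fin T}
    (p : Policy E I) {used : Finset (Fin T)} (hp : p.FeasibleFrom arr used) (o : E → Finset I)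
    {e : E} (he : e ∈ p.chosen o) : arr e ∉ used := by
  induction p generalizing used with
  | finish => simp [Policy.chosen] at he
  | choose a next ih =>
    rcases Finset.mem_insert.1 he with rfl | he
    · exact hp.1
    · exact fun h => ih _ (hp.2 _) he (Finset.mem_insert_of_mem h)

theorem Policy.injOn_chosen {E I : Type*} [DecidableEq E] {T : ℕ} {arr : E → Fin T}
    (p : Policy E I) {used : Finset (Fin T)} (hp : p.FeasibleFrom arr used) (o : E → Finset I) :
    Set.InjOn arr (p.chosen o) := by
  induction p generalizing used with
  | finish => simp [Policy.chosen]
  | choose a next ih =>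
    have hnot : ∀ e ∈ (next (o a)).chosen o, arr e ≠ arr a := fun e he h =>
      (next (o a)).arr_notMem_of_mem_chosen (hp.2 _) o he (h ▸ Finset.mem_insert_self _ _)
    intro x hx y hy hxy
    rcases Finset.mem_insert.1 hx with rfl | hx <;> rcases Finset.mem_insert.1 hy with rfl | hy
    · rfl
    · exact absurd hxy.symm (hnot y hy)
    · exact absurd hxy (hnot x hx)
    · exact ih _ (hp.2 _) hx hy hxy

/-- Whether a feasible policy chooses `e` does not depend on what happens at the arrival
of `e`. -/
theorem Policy.mem_chosen_congr {E I : Type*} [DecidableEq E] {T : ℕ} {arr : E → Fin T}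
    (p : Policy E I) {used : Finset (Fin T)} (hp : p.FeasibleFrom arr used) {o o' : E → Finset I}
    {e : E} (ho : ∀ a, arr a ≠ arr e → o a = o' a) :
    e ∈ p.chosen o ↔ e ∈ p.chosen o' := by
  induction p generalizing used with
  | finish => simp [Policy.chosen]
  | choose a next ih =>
    by_cases ha : arr a = arr e
    -- Once `a` has used up this arrival, `e` is chosen only if it equals `a`, whatever is observed.
    · have hnot : ∀ o : E → Finset I, e ∉ (next (o a)).chosen o := fun o he =>
        (next (o a)).arr_notMem_of_mem_chosen (hp.2 _) o he (ha ▸ Finset.mem_insert_self _ _)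
      simp only [Policy.chosen, Finset.mem_insert, hnot]
    · simp only [Policy.chosen, Finset.mem_insert]
      rw [← ho a ha, ih _ (hp.2 _)]

/-! ### Measurability and independence of the outcomes. -/

namespace Instance

variable {I : Type*} [Fintype I] [DecidableEq I] {T : ℕ}
  {Ω : Type*} [mΩ : MeasurableSpace Ω] {P : Measure Ω} (G : Instance I T Ω P)

/-- A function of the outcomes is measurable with respect to every `σ`-algebra that contains the
events on which it depends. -/
theorem measurable_comp_outcome {Ω : Type*} {m mΩ : MeasurableSpace Ω} {P : Measure Ω}
    (G : Instance I T Ω P) (s : Set (Fin T))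
    (hm : ∀ e : G.N, arrival e ∈ s → ∀ i ∈ resources e, MeasurableSet[m] (G.act e i))
    {h : (G.N → Finset I) → ℝ} (hh : ∀ o o', (∀ e, arrival e ∈ s → o e = o' e) → h o = h o') :
    Measurable[m] (fun ω => h (G.outcome ω)) := by
  classical
  let mQ : MeasurableSpace (G.N → Finset I) := ⊤
  -- Masking the outcomes outside `s` leaves `h` unchanged, and `K` takes values in a finite
  -- discrete space.
  let K : Ω → G.N → Finset I := fun ω e => if arrival e ∈ s then G.outcome ω e else ∅
  have hK : Measurable[m] K := by
    refine @measurable_to_countable' _ _ mQ _ m K fun o => ?_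
    have : K ⁻¹' {o} = ⋂ (e : G.N) (i : I), {ω | i ∈ K ω e ↔ i ∈ o e} := by
      ext ω
      simp [funext_iff, Finset.ext_iff]
    rw [this]
    refine @MeasurableSet.iInter Ω _ m _ _ fun e => @MeasurableSet.iInter Ω _ m _ _ fun i => ?_
    have hmem : @MeasurableSet Ω m {ω | i ∈ K ω e} := by
      by_cases hi : arrival e ∈ s ∧ i ∈ resources e
      · convert hm e hi.1 i hi.2 using 1
        ext ω
        simp [K, hi.1, outcome, hi.2]
      · convert @MeasurableSet.empty Ω m using 1
        ext ω
        by_cases hs : arrival e ∈ s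
        · have hi' : i ∉ resources e := fun h => hi ⟨hs, h⟩
          simp [K, hs, outcome, hi']
        · simp [K, hs]
    by_cases ho : i ∈ o e
    · simpa [ho] using hmem
    · convert @MeasurableSet.compl Ω _ m hmem using 1
      ext ω
      simp [ho]
  have : (fun ω => h (G.outcome ω)) = h ∘ K := by
    funext ω
    refine hh _ _ fun e he => ?_
    simp [K, he]
  rw [this]
  exact (measurable_from_top (f := h)).comp hK

theorem integrable_comp_outcome [IsFiniteMeasure P] (h : (G.N → Finset I) → ℝ) :
    Integrable (fun ω => h (G.outcome ω)) P := by
  have hmeas : Measurable (fun ω => h (G.outcome ω)) :=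
    G.measurable_comp_outcome Set.univ (fun e _ => G.act_measurable e)
      (fun o o' ho => congrArg h (funext fun e => ho e trivial))
  obtain ⟨C, hC⟩ := (Set.finite_range fun o => ‖h o‖).bddAbove
  exact Integrable.of_bound hmeas.aestronglyMeasurable C
    (Filter.Eventually.of_forall fun ω => hC ⟨G.outcome ω, rfl⟩)

/-- The activity of a resource in `e` is independent of everything that happens at the other
arrivals. -/
theorem integral_act_mul [IsProbabilityMeasure P] (e : G.N) {i : I} (hi : i ∈ resources e)
    {h : (G.N → Finset I) → ℝ}
    (hh : ∀ o o', (∀ a, arrival a ≠ arrival e → o a = o' a) → h o = h o') :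
    ∫ ω, (if i ∈ G.outcome ω e then 1 else 0) * h (G.outcome ω) ∂P =
      G.prob i e * ∫ ω, h (G.outcome ω) ∂P := by
  classical
  set m : Fin T → MeasurableSpace Ω := fun t => MeasurableSpace.generateFrom
    {s : Set Ω | ∃ e : G.N, arrival e = t ∧ ∃ i ∈ resources e, s = G.act e i}
  have hle : ∀ t, m t ≤ mΩ := fun t => MeasurableSpace.generateFrom_le fun s ⟨a, _, j, hj, hs⟩ =>
    hs ▸ G.act_measurable a j hj
  have hact : ∀ a : G.N, ∀ j ∈ resources a, MeasurableSet[m (arrival a)] (G.act a j) :=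
    fun a j hj => MeasurableSpace.measurableSet_generateFrom ⟨a, rfl, j, hj, rfl⟩
  have hsup : ∀ (S : Set (Fin T)) (a : G.N), arrival a ∈ S → ∀ j ∈ resources a,
      MeasurableSet[⨆ t ∈ S, m t] (G.act a j) := fun S a ha j hj =>
    (le_iSup₂ (f := fun t (_ : t ∈ S) => m t) (arrival a) ha) _ (hact a j hj)
  have hind : Indep (⨆ t ∈ ({arrival e} : Set (Fin T)), m t)
      (⨆ t ∈ ({arrival e}ᶜ : Set (Fin T)), m t) P :=
    indep_iSup_of_disjoint hle G.act_indep disjoint_compl_right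
  have hX := G.measurable_comp_outcome (m := ⨆ t ∈ ({arrival e} : Set (Fin T)), m t)
    {arrival e} (hsup _) (h := fun o => if i ∈ o e then 1 else 0)
    (fun o o' ho => by rw [ho e rfl])
  have hY := G.measurable_comp_outcome (m := ⨆ t ∈ ({arrival e}ᶜ : Set (Fin T)), m t)
    {arrival e}ᶜ (hsup _) (h := h) hh
  have hXY : IndepFun (fun ω => if i ∈ G.outcome ω e then (1 : ℝ) else 0)
      (fun ω => h (G.outcome ω)) P :=
    indep_of_indep_of_le_left (indep_of_indep_of_le_right hind hY.comap_le) hX.comap_le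
  rw [hXY.integral_fun_mul_eq_mul_integral
    (G.integrable_comp_outcome (fun o => if i ∈ o e then 1 else 0)).aestronglyMeasurable
    (G.integrable_comp_outcome h).aestronglyMeasurable]
  congr 1
  rw [prob, ← integral_indicator_one (G.act_measurable e i hi)]
  refine integral_congr_ae (Filter.Eventually.of_forall fun ω => ?_)
  simp [outcome, hi, Set.indicator_apply]

theorem prob_nonneg (i : I) (e : G.N) : 0 ≤ G.prob i e := measureReal_nonneg

theorem prob_le_one [IsProbabilityMeasure P] (i : I) (e : G.N) : G.prob i e ≤ 1 :=
  measureReal_le_one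

theorem mem_resources_of_mem_outcome {i : I} {e : G.N} {ω : Ω} (h : i ∈ G.outcome ω e) :
    i ∈ resources e := by
  classical
  exact (Finset.mem_filter.1 h).1

theorem F_eq_weightedSum (i : I) (S : Finset G.N) :
    G.F i S = weightedSum (G.prob i) (G.Ni i) (fun X => G.f i (X ∩ S)) := rfl

theorem F_mono [IsProbabilityMeasure P] (i : I) : Monotone (G.F i) := fun S S' h => by
  rw [F_eq_weightedSum, F_eq_weightedSum]
  exact weightedSum_mono (G.prob_nonneg i) (G.prob_le_one i) _
    (fun X _ => G.f_mono i (Finset.inter_subset_inter_left h))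

theorem F_empty (i : I) : G.F i ∅ = 0 := by
  simp [F, G.f_empty]

theorem gain_nonneg [IsProbabilityMeasure P] (e : G.N) (S : Finset G.N) : 0 ≤ G.gain e S :=
  Finset.sum_nonneg fun i _ => sub_nonneg.2 (G.F_mono i Finset.subset_union_right)

/-! ### Expected rewards and greedy gains. -/

/-- If `A` has at most one configuration per arrival, then its configurations are active
independently. -/
theorem integral_filter_outcome [IsProbabilityMeasure P] (i : I) {A : Finset G.N}
    (hA : Set.InjOn arrival (A : Set G.N)) (g : Finset G.N → ℝ) :
    ∫ ω, g (A.filter (fun e => i ∈ G.outcome ω e)) ∂P =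
      weightedSum (G.prob i) (G.Ni i ∩ A) g := by
  induction A using Finset.induction_on generalizing g with
  | empty => simp
  | insert e A he ih =>
    have hA' : Set.InjOn arrival (A : Set G.N) :=
      hA.mono (by simp)
    by_cases hi : i ∈ resources e
    · have heN : e ∈ G.Ni i := by simp [Ni, hi]
      rw [Finset.inter_insert_of_mem heN,
        weightedSum_insert _ (fun h => he (Finset.mem_inter.1 h).2), ← ih hA', ← ih hA']
      have hne : ∀ a ∈ A, arrival a ≠ arrival e := fun a ha h =>
        he ((hA (by simp [ha]) (by simp) h) ▸ ha)
      have hcongr : ∀ o o' : G.N → Finset I, (∀ a, arrival a ≠ arrival e → o a = o' a) →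
          A.filter (fun e => i ∈ o e) = A.filter (fun e => i ∈ o' e) := fun o o' ho =>
        Finset.filter_congr fun a ha => by rw [ho a (hne a ha)]
      -- The increment of `g` due to `e` depends only on other arrivals, so the activity of `e`
      -- factors out of its expectation.
      have h1 := G.integral_act_mul e hi
        (h := fun o => g (insert e (A.filter (fun e => i ∈ o e)))
          - g (A.filter (fun e => i ∈ o e)))
        (fun o o' ho => by simp only [hcongr o o' ho])
      have hsub : ∫ ω, (g (insert e (A.filter (fun e => i ∈ G.outcome ω e)))
            - g (A.filter (fun e => i ∈ G.outcome ω e))) ∂P =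
          ∫ ω, g (insert e (A.filter (fun e => i ∈ G.outcome ω e))) ∂P
            - ∫ ω, g (A.filter (fun e => i ∈ G.outcome ω e)) ∂P :=
        integral_sub
          (G.integrable_comp_outcome fun o => g (insert e (A.filter (fun e => i ∈ o e))))
          (G.integrable_comp_outcome fun o => g (A.filter (fun e => i ∈ o e)))
      rw [hsub] at h1
      have h2 : ∫ ω, g ((insert e A).filter (fun e => i ∈ G.outcome ω e)) ∂P =
          ∫ ω, g (A.filter (fun e => i ∈ G.outcome ω e)) ∂P +
          ∫ ω, (if i ∈ G.outcome ω e then 1 else 0) *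
            (g (insert e (A.filter (fun e => i ∈ G.outcome ω e)))
              - g (A.filter (fun e => i ∈ G.outcome ω e))) ∂P := by
        rw [← integral_add
          (G.integrable_comp_outcome fun o => g (A.filter (fun e => i ∈ o e)))
          (G.integrable_comp_outcome fun o => (if i ∈ o e then 1 else 0) *
            (g (insert e (A.filter (fun e => i ∈ o e))) - g (A.filter (fun e => i ∈ o e))))]
        refine integral_congr_ae (Filter.Eventually.of_forall fun ω => ?_)
        by_cases hω : i ∈ G.outcome ω e <;> simp [Finset.filter_insert, hω]
      rw [h2, h1]
      ring
    · have heN : e ∉ G.Ni i := by simp [Ni, hi]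
      rw [Finset.inter_insert_of_notMem heN, ← ih hA']
      refine integral_congr_ae (Filter.Eventually.of_forall fun ω => ?_)
      have hω : i ∉ G.outcome ω e := fun h => hi (G.mem_resources_of_mem_outcome h)
      simp [Finset.filter_insert, hω]

/-- The expected reward of a non-adaptive choice of at most one configuration per arrival. -/
theorem alg_eq_sum_F [IsProbabilityMeasure P] {A : Finset G.N}
    (hA : Set.InjOn arrival (A : Set G.N)) : G.alg A = ∑ i, G.F i A := by
  rw [alg]
  unfold reward
  rw [integral_finsetSum _ (fun i _ =>
    G.integrable_comp_outcome fun o => G.f i (A.filter (fun e => i ∈ o e)))]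
  refine Finset.sum_congr rfl fun i _ => ?_
  rw [G.integral_filter_outcome i hA, F_eq_weightedSum, weightedSum_inter]

/-- The marginal values of the elements in the order of arrival add up to the total value. -/
theorem sum_gain_before {A : Finset G.N} (hA : Set.InjOn arrival (A : Set G.N)) :
    ∑ e ∈ A, G.gain e (G.before A (arrival e)) = ∑ i, G.F i A := by
  induction A using Finset.induction_on_max_value (arrival (N := G.N)) with
  | empty => simp [F_empty]
  | insert e A he hmax ih =>
    have hlt : ∀ a ∈ A, arrival a < arrival e := fun a ha =>
      lt_of_le_of_ne (hmax a ha) fun h => he ((hA (by simp [ha]) (by simp) h) ▸ ha)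
    have h1 : G.before (insert e A) (arrival e) = A := by
      rw [before, Finset.filter_insert, if_neg (lt_irrefl _), Finset.filter_true_of_mem hlt]
    have h2 : ∀ a ∈ A, G.before (insert e A) (arrival a) = G.before A (arrival a) := fun a ha => by
      rw [before, Finset.filter_insert, if_neg (hlt a ha).not_gt, before]
    rw [Finset.sum_insert he, h1, Finset.sum_congr rfl fun a ha => by rw [h2 a ha],
      ih (hA.mono (by simp)), gain, ← Finset.sum_add_distrib]
    refine Finset.sum_congr rfl fun i _ => ?_
    rw [marginal, ← Finset.insert_eq]
    ring

variable {G} in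
theorem IsGreedy.injOn_arrival {A : Finset G.N} (hA : G.IsGreedy A) :
    Set.InjOn arrival (A : Set G.N) := by
  intro x hx y hy hxy
  have hxN : x ∈ G.Nt (arrival x) := by simp [Nt]
  have hyN : y ∈ G.Nt (arrival x) := by simp [Nt, hxy]
  obtain ⟨e, _, he, _⟩ := hA (arrival x) ⟨x, hxN⟩
  have h1 : x ∈ A ∩ G.Nt (arrival x) := Finset.mem_inter.2 ⟨hx, hxN⟩
  have h2 : y ∈ A ∩ G.Nt (arrival x) := Finset.mem_inter.2 ⟨hy, hyN⟩
  rw [he, Finset.mem_singleton] at h1 h2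
  rw [h1, h2]

variable {G} in
/-- No choice of at most one configuration per arrival has marginal values, with respect to the
earlier greedy choices, that add up to more than those of the greedy choices. -/
theorem IsGreedy.sum_gain_le [IsProbabilityMeasure P] {A : Finset G.N} (hA : G.IsGreedy A)
    {S : Finset G.N} (hS : Set.InjOn arrival (S : Set G.N)) :
    ∑ e ∈ S, G.gain e (G.before A (arrival e)) ≤ ∑ e ∈ A, G.gain e (G.before A (arrival e)) := by
  have hex : ∀ e : G.N, ∃ a ∈ A, arrival a = arrival e ∧
      G.gain e (G.before A (arrival e)) ≤ G.gain a (G.before A (arrival e)) := by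
    intro e
    have heN : e ∈ G.Nt (arrival e) := by simp [Nt]
    obtain ⟨a, haN, ha, hmax⟩ := hA (arrival e) ⟨e, heN⟩
    have haA : a ∈ A ∩ G.Nt (arrival e) := ha ▸ Finset.mem_singleton_self a
    exact ⟨a, (Finset.mem_inter.1 haA).1, (Finset.mem_filter.1 haN).2, hmax e heN⟩
  choose φ hφA hφarr hφ using hex
  -- `φ` keeps the arrival, and `S` has at most one element per arrival.
  have hinj : Set.InjOn φ (S : Set G.N) := fun x hx y hy hxy =>
    hS hx hy (by rw [← hφarr x, ← hφarr y, hxy])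
  calc ∑ e ∈ S, G.gain e (G.before A (arrival e))
      ≤ ∑ e ∈ S, G.gain (φ e) (G.before A (arrival (φ e))) :=
        Finset.sum_le_sum fun e _ => by rw [hφarr]; exact hφ e
    _ = ∑ a ∈ S.image φ, G.gain a (G.before A (arrival a)) := 
        (Finset.sum_image (f := fun a => G.gain a (G.before A (arrival a))) hinj).symm
    _ ≤ _ := Finset.sum_le_sum_of_subset_of_nonneg
        (Finset.image_subset_iff.2 fun e _ => hφA e) (fun a _ _ => G.gain_nonneg _ _)

/-! ### Comparison of an adaptive policy with Greedy. -/

/-- The expected marginal value of `e`, given that `i` is active in `e`, with respect to the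
active configurations of `A` that arrive before `e`. -/
def activeGain (i : I) (A : Finset G.N) (e : G.N) : ℝ :=
  weightedSum (G.prob i) (G.Ni i) fun X =>
    G.f i (insert e (X ∩ G.before A (arrival e))) - G.f i (X ∩ G.before A (arrival e))

theorem marginal_F_eq_prob_mul (i : I) (A : Finset G.N) {e : G.N} (hi : i ∈ resources e) :
    marginal (G.F i) {e} (G.before A (arrival e)) = G.prob i e * G.activeGain i A e := by
  have heN : e ∈ G.Ni i := by simp [Ni, hi]
  have heA : e ∉ G.before A (arrival e) := by simp [before]
  rw [marginal, ← Finset.insert_eq, F_eq_weightedSum, F_eq_weightedSum,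
    weightedSum_marginal _ heN heA, activeGain]

theorem marginal_F_eq_zero (i : I) (S : Finset G.N) {e : G.N} (hi : i ∉ resources e) :
    marginal (G.F i) {e} S = 0 := by
  have heN : e ∉ G.Ni i := by simp [Ni, hi]
  rw [marginal, ← Finset.insert_eq, F, F, sub_eq_zero]
  refine Finset.sum_congr rfl fun X hX => ?_
  rw [Finset.inter_insert_of_notMem fun h => heN (Finset.mem_powerset.1 hX h)]

/-- Only the sample `X` is averaged while `S` stays fixed, so `S` may later be replaced by a random
set correlated with the true outcomes. -/
theorem f_le_F_add_sum [IsProbabilityMeasure P] (i : I) (S A : Finset G.N) :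
    G.f i S ≤ G.F i A + ∑ e ∈ S, G.activeGain i A e := by
  have hpt : ∀ X ⊆ G.Ni i, G.f i S ≤ G.f i (X ∩ A) + ∑ e ∈ S,
      (G.f i (insert e (X ∩ G.before A (arrival e))) - G.f i (X ∩ G.before A (arrival e))) := by
    intro X _
    have h := (G.f_submodularOrder i).union_le (G.f_mono i) S (X ∩ A)
    simp only [← Finset.inter_filter] at h
    exact (G.f_mono i Finset.subset_union_left).trans h
  have h := weightedSum_mono (G.prob_nonneg i) (G.prob_le_one i) (G.Ni i) hpt
  rwa [weightedSum_const, weightedSum_add, weightedSum_sum] at h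

variable {G} in
/-- The value of an adaptive policy is at most twice the value of Greedy. -/
theorem IsGreedy.policyValue_le [IsProbabilityMeasure P] {A : Finset G.N} (hA : G.IsGreedy A)
    {p : Policy G.N I} (hp : p.Feasible arrival) : G.policyValue p ≤ 2 * G.alg A := by
  have hpt : ∀ ω, G.reward (p.chosen (G.outcome ω)) ω ≤ ∑ i, G.F i A +
      ∑ i, ∑ e, (if i ∈ G.outcome ω e then 1 else 0) *
        (if e ∈ p.chosen (G.outcome ω) then G.activeGain i A e else 0) := by
    intro ω
    rw [reward, ← Finset.sum_add_distrib]
    refine Finset.sum_le_sum fun i _ => (G.f_le_F_add_sum i _ A).trans_eq ?_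
    congr 1
    have h := Finset.sum_ite_mem Finset.univ (p.chosen (G.outcome ω))
      (fun e => if i ∈ G.outcome ω e then G.activeGain i A e else 0)
    rw [Finset.univ_inter] at h
    rw [Finset.sum_filter, ← h]
    refine Finset.sum_congr rfl fun e _ => ?_
    split_ifs <;> simp
  -- Non-anticipation enters here: the choice of `e` is a function of the outcomes at other
  -- arrivals.
  have hterm : ∀ i e, ∫ ω, (if i ∈ G.outcome ω e then 1 else 0) *
        (if e ∈ p.chosen (G.outcome ω) then G.activeGain i A e else 0) ∂P =
      ∫ ω, (if e ∈ p.chosen (G.outcome ω) then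
        marginal (G.F i) {e} (G.before A (arrival e)) else 0) ∂P := by
    intro i e
    by_cases hi : i ∈ resources e
    · rw [G.integral_act_mul e hi (h := fun o => if e ∈ p.chosen o then G.activeGain i A e else 0)
        (fun o o' ho => by simp only [p.mem_chosen_congr hp ho]), ← integral_const_mul]
      simp only [mul_ite, mul_zero, G.marginal_F_eq_prob_mul i A hi]
    · have : ∀ ω, i ∉ G.outcome ω e := fun ω h => hi (G.mem_resources_of_mem_outcome h)
      simp [this, G.marginal_F_eq_zero i _ hi]
  have hint1 : ∀ i (e : G.N), Integrable (fun ω => (if i ∈ G.outcome ω e then (1 : ℝ) else 0) *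
        (if e ∈ p.chosen (G.outcome ω) then G.activeGain i A e else 0)) P := fun i e =>
    G.integrable_comp_outcome fun o => (if i ∈ o e then (1 : ℝ) else 0) *
        (if e ∈ p.chosen o then G.activeGain i A e else 0)
  have hint2 : ∀ i (e : G.N), Integrable (fun ω => if e ∈ p.chosen (G.outcome ω) then
        marginal (G.F i) {e} (G.before A (arrival e)) else 0) P := fun i e =>
    G.integrable_comp_outcome fun o => if e ∈ p.chosen o then
        marginal (G.F i) {e} (G.before A (arrival e)) else 0
  -- The comparison with Greedy holds in each realization, since the marginals of `F` no longer
  -- depend on `ω`.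
  have hsum : ∀ ω, ∑ i, ∑ e, (if e ∈ p.chosen (G.outcome ω) then
        marginal (G.F i) {e} (G.before A (arrival e)) else 0) ≤ ∑ i, G.F i A := by
    intro ω
    rw [← G.sum_gain_before hA.injOn_arrival, Finset.sum_comm]
    refine le_trans (le_of_eq ?_) (hA.sum_gain_le (p.injOn_chosen hp (G.outcome ω)))
    rw [← Finset.univ_inter (p.chosen (G.outcome ω)), ← Finset.sum_ite_mem, Finset.univ_inter]
    refine Finset.sum_congr rfl fun e _ => ?_
    split_ifs <;> simp [gain]
  calc G.policyValue p
      ≤ ∫ ω, (∑ i, G.F i A + ∑ i, ∑ e, (if i ∈ G.outcome ω e then 1 else 0) *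
        (if e ∈ p.chosen (G.outcome ω) then G.activeGain i A e else 0)) ∂P := by
        refine integral_mono ?_ ?_ hpt
        · exact G.integrable_comp_outcome fun o =>
            ∑ i, G.f i ((p.chosen o).filter (fun e => i ∈ o e))
        · exact (integrable_const _).add (integrable_finsetSum _ fun i _ =>
            integrable_finsetSum _ fun e _ => hint1 i e)
    _ = ∑ i, G.F i A + ∫ ω, ∑ i, ∑ e, (if e ∈ p.chosen (G.outcome ω) then
        marginal (G.F i) {e} (G.before A (arrival e)) else 0) ∂P := by
        rw [integral_add (integrable_const _) (integrable_finsetSum _ fun i _ =>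
            integrable_finsetSum _ fun e _ => hint1 i e), integral_const, probReal_univ, one_smul,
          integral_finsetSum _ fun i _ => integrable_finsetSum _ fun e _ => hint1 i e,
          integral_finsetSum _ fun i _ => integrable_finsetSum _ fun e _ => hint2 i e]
        congr 1
        refine Finset.sum_congr rfl fun i _ => ?_
        rw [integral_finsetSum _ fun e _ => hint1 i e, integral_finsetSum _ fun e _ => hint2 i e]
        exact Finset.sum_congr rfl fun e _ => hterm i e
    _ ≤ ∑ i, G.F i A + ∫ _, ∑ i, G.F i A ∂P := by
        refine add_le_add le_rfl (integral_mono (integrable_finsetSum _ fun i _ =>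
          integrable_finsetSum _ fun e _ => hint2 i e) (integrable_const _) hsum)
    _ = 2 * G.alg A := by
        rw [integral_const, probReal_univ, one_smul, G.alg_eq_sum_F hA.injOn_arrival]
        ring

/-! ### Existence of a greedy run. -/

theorem exists_isGreedy : ∃ A : Finset G.N, G.IsGreedy A := by
  -- Induction on the number of processed arrivals; later insertions do not affect `before` at
  -- earlier arrivals.
  suffices h : ∀ k : ℕ, ∃ A : Finset G.N, (∀ e ∈ A, (arrival e : ℕ) < k) ∧
      ∀ t : Fin T, (t : ℕ) < k → (G.Nt t).Nonempty → ∃ e ∈ G.Nt t, A ∩ G.Nt t = {e} ∧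
        ∀ e' ∈ G.Nt t, G.gain e' (G.before A t) ≤ G.gain e (G.before A t) by
    obtain ⟨A, _, hA⟩ := h T
    exact ⟨A, fun t => hA t t.2⟩
  intro k
  induction k with
  | zero => exact ⟨∅, by simp, fun t ht => absurd ht (Nat.not_lt_zero _)⟩
  | succ k ih =>
    obtain ⟨A, hAk, hA⟩ := ih
    by_cases hk : ∃ t : Fin T, (t : ℕ) = k ∧ (G.Nt t).Nonempty
    · obtain ⟨s, rfl, hs⟩ := hk
      obtain ⟨a, ha, hmax⟩ := (G.Nt s).exists_max_image (fun e => G.gain e A) hs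
      have has : arrival a = s := (Finset.mem_filter.1 ha).2
      have hbefore : ∀ t : Fin T, t ≤ s → G.before (insert a A) t = G.before A t := fun t ht => by
        rw [before, Finset.filter_insert, if_neg (by rw [has]; exact ht.not_gt), before]
      refine ⟨insert a A, fun e he => ?_, fun t ht hne => ?_⟩
      · rcases Finset.mem_insert.1 he with rfl | he
        · rw [has]; exact Nat.lt_succ_self _
        · exact (hAk e he).trans (Nat.lt_succ_self _)
      · rcases Nat.lt_succ_iff_lt_or_eq.1 ht with ht | ht
        · obtain ⟨e, he, heq, hle⟩ := hA t ht hne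
          have hat : a ∉ G.Nt t := fun h => by
            have : arrival a = t := (Finset.mem_filter.1 h).2
            rw [← this, has] at ht
            exact lt_irrefl _ ht
          refine ⟨e, he, ?_, ?_⟩
          · rw [Finset.insert_inter_of_notMem hat, heq]
          · rwa [hbefore t (le_of_lt ht)]
        · obtain rfl : t = s := Fin.ext ht
          refine ⟨a, ha, ?_, ?_⟩
          · have : A ∩ G.Nt t = ∅ := by
              refine Finset.eq_empty_of_forall_notMem fun e he => ?_
              have h := hAk e (Finset.mem_inter.1 he).1
              rw [(Finset.mem_filter.1 (Finset.mem_inter.1 he).2).2] at h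
              exact lt_irrefl _ h
            rw [Finset.insert_inter_of_mem ha, this]
            rfl
          · have : G.before A t = A := Finset.filter_true_of_mem fun e he => hAk e he
            rwa [hbefore t le_rfl, this]
    · refine ⟨A, fun e he => (hAk e he).trans (Nat.lt_succ_self _), fun t ht hne => ?_⟩
      rcases Nat.lt_succ_iff_lt_or_eq.1 ht with ht | ht
      · exact hA t ht hne
      · exact absurd ⟨t, ht, hne⟩ hk

end Instance

end OSOW

theorem mainTheorem3 {I : Type*} [Fintype I] [DecidableEq I] {T : ℕ}
    {Ω : Type*} [MeasurableSpace Ω] {P : MeasureTheory.Measure Ω}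
    [MeasureTheory.IsProbabilityMeasure P] (G : OSOW.Instance I T Ω P) :
    (∃ A : Finset G.N, G.IsGreedy A) ∧
    BddAbove G.adaptiveValues ∧
    ∀ A : Finset G.N, G.IsGreedy A → (1 / 2 : ℝ) * G.aopt ≤ G.alg A := by
  have hub : ∀ A : Finset G.N, G.IsGreedy A → ∀ x ∈ G.adaptiveValues, x ≤ 2 * G.alg A := by
    rintro A hA x ⟨p, hp, rfl⟩
    exact hA.policyValue_le hp
  obtain ⟨A₀, hA₀⟩ := G.exists_isGreedy
  refine ⟨⟨A₀, hA₀⟩, ⟨_, hub A₀ hA₀⟩, fun A hA => ?_⟩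
  have h : G.aopt ≤ 2 * G.alg A :=
    -- The policy that chooses nothing shows that the supremum is over a nonempty set.
    csSup_le ⟨_, OSOW.Policy.finish, trivial, rfl⟩ (hub A hA)
  linarith
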